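/- Let $d>1$ and $n\ge 2$ be integers, and work over $\mathbb{C}$. Let $\mu_d=\{\xi\in\mathbb{C}^*\mid \xi^d=1\}$ act on $\mathbb{A}^n$ by scalar multiplication, and let $A_{d,n}:=\mathbb{A}^n/\mu_d$ be the quotient, i.e. the affine variety with coordinate ring $\mathcal{O}(A_{d,n})=\mathbb{C}[x_1,\dots,x_n]^{\mu_d}$. Let $\mathrm{Aut}^{\mu_d}(\mathbb{A}^n)\subset\mathrm{Aut}(\mathbb{A}^n)$ be the (closed) subgroup of automorphisms commuting with every element of $\mu_d$, and let $\phi_d:\mathrm{Aut}^{\mu_d}(\mathbb{A}^n)\to\mathrm{Aut}(A_{d,n})$ be the natural homomorphism, which sends an automorphism to the one it induces on the quotient. For an affine variety $X$ the group $\mathrm{Aut}(X)$ carries its natural structure of an ind-group: if $V\subset\mathcal{O}(X)$ is a finite-dimensional subspace generating $\mathcal{O}(X)$ as an algebra and $F\subset\mathcal{O}(X)$ is finite-dimensional, then the automorphisms $g$ with $g^*(V)\subset F$ and $(g^{-1})^*(V)\subset F$ form a closed subvariety of $\mathrm{Hom}(V,F)^2$ via $g\mapsto(g^*|_V,(g^{-1})^*|_V)$,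 and these subvarieties give the filtration of $\mathrm{Aut}(X)$. A one-dimensional unipotent subgroup of $\mathrm{Aut}(X)$ (or of a closed subgroup of it) is a closed subgroup $U$ that is isomorphic, as an algebraic group, to the additive group $\mathbb{C}^+$. Then: 1. $\phi_d$ is surjective. 2. The kernel of $\phi_d$ is $\mu_d$, embedded in $\mathrm{Aut}^{\mu_d}(\mathbb{A}^n)$ as the group of scalar multiplications. 3. Every one-dimensional unipotent subgroup of $\mathrm{Aut}(A_{d,n})$ is the image under $\phi_d$ of some one-dimensional unipotent subgroup of $\mathrm{Aut}^{\mu_d}(\mathbb{A}^n)$. -/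

import Mathlib

noncomputable section

open Polynomial

/-! ### The ind-variety structure on the automorphism group of an affine variety

An affine variety `X` over `ℂ` is given by its coordinate ring `A = O(X)`, a finitely generated
`ℂ`-algebra.  An automorphism `g` of `X` is recorded by the `ℂ`-algebra automorphism
`f ↦ f ∘ g⁻¹` of `A`; this is a group isomorphism `Aut(X) ≅ (A ≃ₐ[ℂ] A)`. -/

namespace AffAut

variable {A : Type*} [CommRing A] [Algebra ℂ A]

/-- `V` is a finite-dimensional subspace that generates `A` as a `ℂ`-algebra, i.e. it corresponds
to a closed embedding of `X` into the affine space `V^*`. -/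
def Generating (V : Submodule ℂ A) : Prop :=
  FiniteDimensional ℂ V ∧ Algebra.adjoin ℂ (V : Set A) = ⊤

/-- The pieces `{g | g(V) ⊆ F, g⁻¹(V) ⊆ F}` of the natural filtration of `Aut(X)`.
For `V` generating and `F` finite-dimensional, `g ↦ (g|_V, g⁻¹|_V)` identifies the piece with a
Zariski closed subset of the finite-dimensional vector space `Hom(V, F) × Hom(V, F)`; this is its
structure of an affine variety.  For fixed `V` the pieces, with `F` running through an exhausting
ascending sequence of finite-dimensional subspaces, form the filtration of the ind-variety
`Aut(X)`, and different choices of `V` and of the sequence give equivalent filtrations. -/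
def piece (V F : Submodule ℂ A) : Set (A ≃ₐ[ℂ] A) :=
  {g | ∀ v ∈ V, g v ∈ F ∧ g.symm v ∈ F}

/-- Polynomials in the matrix coefficients `g ↦ ℓ (g a)` and `g ↦ ℓ (g⁻¹ a)`, where `a ∈ A` and `ℓ`
is a linear form on `A`.  Since `V` generates `A`, the restrictions of these functions to
`piece V F` are exactly the restrictions of the polynomial functions on `Hom(V, F) × Hom(V, F)`,
that is, the regular functions on the affine variety `piece V F`. -/
def coeffAlgebra (A : Type*) [CommRing A] [Algebra ℂ A] : Subalgebra ℂ ((A ≃ₐ[ℂ] A) → ℂ) :=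
  Algebra.adjoin ℂ
    {c | ∃ (a : A) (l : A →ₗ[ℂ] ℂ), c = (fun g => l (g a)) ∨ c = (fun g => l (g.symm a))}

/-- Closed subsets of the ind-variety `Aut(X)`: the intersection with every piece of the
filtration is the zero set of regular functions in that piece. -/
def IsIndClosed (S : Set (A ≃ₐ[ℂ] A)) : Prop :=
  ∀ V F : Submodule ℂ A, Generating V → FiniteDimensional ℂ F →
    ∃ E : Set ((A ≃ₐ[ℂ] A) → ℂ), E ⊆ coeffAlgebra A ∧
      S ∩ piece V F = {g | g ∈ piece V F ∧ ∀ r ∈ E, r g = 0}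

/-- A map `ℂ → Aut(X)` is a morphism of ind-varieties: it takes values in one piece of the
filtration, and it pulls regular functions back to polynomials. -/
def IsMorphismFromLine (e : ℂ → (A ≃ₐ[ℂ] A)) : Prop :=
  (∃ V F : Submodule ℂ A, Generating V ∧ FiniteDimensional ℂ F ∧ ∀ s, e s ∈ piece V F) ∧
    ∀ r ∈ coeffAlgebra A, ∃ p : ℂ[X], ∀ s : ℂ, r (e s) = p.eval s

/-- A function on a closed subset `S` of `Aut(X)` is a morphism of ind-varieties `S → ℂ`: on the
intersection of `S` with every piece it is the restriction of a regular function. -/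
def IsMorphismToLine (S : Set (A ≃ₐ[ℂ] A)) (t : S → ℂ) : Prop :=
  ∀ V F : Submodule ℂ A, Generating V → FiniteDimensional ℂ F →
    ∃ r ∈ coeffAlgebra A, ∀ u : S, (u : A ≃ₐ[ℂ] A) ∈ piece V F → t u = r u

/-- A one-dimensional unipotent subgroup of `Aut(X)`: a closed subgroup `U` that is isomorphic to
the additive group `ℂ⁺`, by a group isomorphism that is an isomorphism of ind-varieties. -/
def IsOneDimUnipotent (U : Subgroup (A ≃ₐ[ℂ] A)) : Prop :=
  IsIndClosed (U : Set (A ≃ₐ[ℂ] A)) ∧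
    ∃ e : Multiplicative ℂ ≃* U,
      IsMorphismFromLine (fun s : ℂ => (e (Multiplicative.ofAdd s) : A ≃ₐ[ℂ] A)) ∧
      IsMorphismToLine (U : Set (A ≃ₐ[ℂ] A)) (fun u => Multiplicative.toAdd (e.symm u))

/-! ### Quotients by a group of automorphisms -/

/-- `Aut^H(X)`: the automorphisms of `X` that commute with every element of `H`. -/
def equivariant (H : Subgroup (A ≃ₐ[ℂ] A)) : Subgroup (A ≃ₐ[ℂ] A) :=
  Subgroup.centralizer (H : Set (A ≃ₐ[ℂ] A))

/-- `O(X / H) = O(X)^H`, the algebra of invariants. -/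
def invariants (H : Subgroup (A ≃ₐ[ℂ] A)) : Subalgebra ℂ A where
  carrier := {f | ∀ h ∈ H, h f = f}
  mul_mem' := fun ha hb h hh => by rw [map_mul, ha h hh, hb h hh]
  add_mem' := fun ha hb h hh => by rw [map_add, ha h hh, hb h hh]
  algebraMap_mem' := fun c h _ => h.commutes c

theorem equivariant_apply_mem {H : Subgroup (A ≃ₐ[ℂ] A)} {g : A ≃ₐ[ℂ] A}
    (hg : g ∈ equivariant H) {f : A} (hf : f ∈ invariants H) : g f ∈ invariants H := by
  intro h hh
  have h1 : h * g = g * h := Subgroup.mem_centralizer_iff.mp hg h hh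
  calc h (g f) = (h * g) f := rfl
    _ = g (h f) := by rw [h1]; rfl
    _ = g f := by rw [hf h hh]

/-- The natural homomorphism `Aut^H(X) → Aut(X / H)`: restriction to the invariants. -/
def quotientHom (H : Subgroup (A ≃ₐ[ℂ] A)) :
    equivariant H →* (invariants H ≃ₐ[ℂ] invariants H) where
  toFun g := AlgEquiv.ofAlgHom
    (((g : A ≃ₐ[ℂ] A).toAlgHom.comp (invariants H).val).codRestrict (invariants H)
      fun f => equivariant_apply_mem g.2 f.2)
    (((g⁻¹ : equivariant H) : A ≃ₐ[ℂ] A).toAlgHom.comp (invariants H).val |>.codRestrict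
      (invariants H) fun f => equivariant_apply_mem (g⁻¹).2 f.2)
    (by ext f; exact (g : A ≃ₐ[ℂ] A).apply_symm_apply f)
    (by ext f; exact (g : A ≃ₐ[ℂ] A).symm_apply_apply f)
  map_one' := by ext f; rfl
  map_mul' g g' := by ext f; rfl

end AffAut

/-! ### The action of `μ_d` on affine space by scalar multiplication -/

/-- The algebra endomorphism `f ↦ f (c x)` of `ℂ[x_1, …, x_n]`. -/
def scalarHom (n : ℕ) (c : ℂ) : MvPolynomial (Fin n) ℂ →ₐ[ℂ] MvPolynomial (Fin n) ℂ :=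
  MvPolynomial.aeval fun i => MvPolynomial.C c * MvPolynomial.X i

theorem scalarHom_one (n : ℕ) : scalarHom n 1 = AlgHom.id ℂ _ := by
  refine MvPolynomial.algHom_ext fun i => ?_
  rw [scalarHom, MvPolynomial.aeval_X, map_one, one_mul, AlgHom.id_apply]

theorem scalarHom_comp (n : ℕ) (b c : ℂ) :
    (scalarHom n b).comp (scalarHom n c) = scalarHom n (b * c) := by
  refine MvPolynomial.algHom_ext fun i => ?_
  rw [AlgHom.comp_apply, scalarHom, scalarHom, scalarHom, MvPolynomial.aeval_X,
    MvPolynomial.aeval_X, map_mul, MvPolynomial.aeval_X, MvPolynomial.algHom_C,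
    MvPolynomial.algebraMap_eq, map_mul]
  ring

/-- Scalar multiplication by `c` on `𝔸^n`, acting on functions by `f ↦ f (c⁻¹ x)`. -/
def scalarAut (n : ℕ) : ℂˣ →* (MvPolynomial (Fin n) ℂ ≃ₐ[ℂ] MvPolynomial (Fin n) ℂ) where
  toFun c := AlgEquiv.ofAlgHom (scalarHom n ((c⁻¹ : ℂˣ) : ℂ)) (scalarHom n (c : ℂ))
    (by rw [scalarHom_comp, Units.inv_mul, scalarHom_one])
    (by rw [scalarHom_comp, Units.mul_inv, scalarHom_one])
  map_one' := AlgEquiv.ext fun f => by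
    change scalarHom n ((1⁻¹ : ℂˣ) : ℂ) f = f
    rw [inv_one, Units.val_one, scalarHom_one, AlgHom.id_apply]
  map_mul' b c := AlgEquiv.ext fun f => by
    change scalarHom n (((b * c)⁻¹ : ℂˣ) : ℂ) f =
      scalarHom n ((b⁻¹ : ℂˣ) : ℂ) (scalarHom n ((c⁻¹ : ℂˣ) : ℂ) f)
    rw [mul_inv, Units.val_mul, ← scalarHom_comp, AlgHom.comp_apply]

/-- The image of `μ_d = {ξ ∈ ℂ^* | ξ^d = 1}` in `Aut(𝔸^n)`. -/
def muSubgroup (d n : ℕ) :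
    Subgroup (MvPolynomial (Fin n) ℂ ≃ₐ[ℂ] MvPolynomial (Fin n) ℂ) :=
  (rootsOfUnity d ℂ).map (scalarAut n)

/-- `Aut^{μ_d}(𝔸^n)`. -/
abbrev AutMu (d n : ℕ) : Subgroup (MvPolynomial (Fin n) ℂ ≃ₐ[ℂ] MvPolynomial (Fin n) ℂ) :=
  AffAut.equivariant (muSubgroup d n)

/-- The coordinate ring `O(A_{d,n}) = ℂ[x_1, …, x_n]^{μ_d}` of `A_{d,n} = 𝔸^n / μ_d`. -/
abbrev CoordRing (d n : ℕ) : Subalgebra ℂ (MvPolynomial (Fin n) ℂ) :=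
  AffAut.invariants (muSubgroup d n)

/-- The natural homomorphism `φ_d : Aut^{μ_d}(𝔸^n) → Aut(A_{d,n})`. -/
def phi (d n : ℕ) : AutMu d n →* (CoordRing d n ≃ₐ[ℂ] CoordRing d n) :=
  AffAut.quotientHom (muSubgroup d n)

/-- The embedding of `μ_d` into `Aut^{μ_d}(𝔸^n)` by scalar multiplications. -/
def muHom (d n : ℕ) : rootsOfUnity d ℂ →* AutMu d n :=
  ((scalarAut n).comp (rootsOfUnity d ℂ).subtype).codRestrict (AutMu d n) (by
    intro c
    refine Subgroup.mem_centralizer_iff.mpr ?_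
    rintro _ ⟨c', _, rfl⟩
    change scalarAut n c' * scalarAut n c = scalarAut n c * scalarAut n c'
    rw [← map_mul, ← map_mul, mul_comm])

end

/-!
Idea of the proof. Let `g` be an automorphism of the invariants and `f_j = g (x_j ^ d)`.
A prime ideal containing all `x_j ^ d` contains every non-constant monomial invariant, so a prime
`p` dividing all `f_j` would divide `x_i ^ d - c_i` for every `i`, which is impossible for `n ≥ 2`.
Applying `g` to `(x_i ^ (d - 1) * x_j) ^ d = (x_i ^ d) ^ (d - 1) * x_j ^ d` then shows that every
`f_i` is a `d`-th power, whence `g` extends to `ℂ[x_1, …, x_n]`, uniquely up to `μ_d`. Comparing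
linear terms shows that the extension commutes with `μ_d`. The same argument over the factorial ring
`ℂ[x_1, …, x_n][T]` lifts polynomial families of automorphisms. Two lifts of a family differ by one
scalar independent of the parameter, as for coverings, so a lift of a one-parameter group that is
normalised at `0` is again a one-parameter group.
-/

noncomputable section

open scoped Polynomial
open MvPolynomial

/-! ### Divisibility and powers in factorial rings and polynomial rings -/

theorem exists_associated_pow_of_forall_pow_eq {R ι : Type*} [CommRing R] [IsDomain R]
    [UniqueFactorizationMonoid R] {d : ℕ} [NeZero d] {a : R} {f w : ι → R}
    (hw : ∀ j, w j ^ d = a ^ (d - 1) * f j) (hf : ∀ q, (∀ j, q ∣ f j) → IsUnit q) (ha : a ≠ 0) :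
    ∃ y, Associated (y ^ d) a := by
  classical
  have ha' : Associates.mk a ≠ 0 := Associates.mk_ne_zero.mpr ha
  suffices h : ∀ p : Associates R, Irreducible p → d ∣ p.count (Associates.mk a).factors by
    obtain ⟨b, hb⟩ := Associates.is_pow_of_dvd_count ha' h
    obtain ⟨y, rfl⟩ := Associates.mk_surjective b
    exact ⟨y, (Associates.mk_eq_mk_iff_associated.mp (by rw [hb, Associates.mk_pow])).symm⟩
  intro p hp
  obtain ⟨q, rfl⟩ := Associates.mk_surjective p
  have hq : Irreducible q := Associates.irreducible_mk.mp hp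
  obtain ⟨j, hj⟩ : ∃ j, ¬ q ∣ f j := by
    by_contra! h
    exact hq.not_isUnit (hf q h)
  have hfj : f j ≠ 0 := fun h => hj (h ▸ dvd_zero q)
  have hwj : w j ≠ 0 := fun h => mul_ne_zero (pow_ne_zero (d - 1) ha) hfj (by
    rw [← hw, h, zero_pow (NeZero.ne d)])
  have hcount_f : (Associates.mk q).count (Associates.mk (f j)).factors = 0 := by
    by_contra h
    exact hj ((Associates.count_ne_zero_iff_dvd hfj hq).mp h)
  -- `d * v_q (w j) = (d - 1) * v_q a`, and `d` is coprime to `d - 1`.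
  have hcount := congrArg (fun x => (Associates.mk q).count (Associates.mk x).factors) (hw j)
  simp only [Associates.mk_mul_mk.symm, Associates.mk_pow,
    Associates.count_mul (pow_ne_zero _ ha') (Associates.mk_ne_zero.mpr hfj) hp,
    Associates.count_pow ha' hp, Associates.count_pow (Associates.mk_ne_zero.mpr hwj) hp,
    hcount_f, add_zero] at hcount
  have hcoprime : d.Coprime (d - 1) :=
    (Nat.coprime_self_sub_right (NeZero.one_le)).mpr (Nat.coprime_one_right d)
  exact hcoprime.dvd_of_dvd_mul_left ⟨_, hcount.symm⟩

theorem exists_eq_smul_of_pow_eq_pow {K R : Type*} [Field K] [CommRing R]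
    [IsDomain R] [Algebra K R] {d : ℕ} [NeZero d] {ζ : K} (hζ : IsPrimitiveRoot ζ d) {x y : R}
    (h : x ^ d = y ^ d) : ∃ c : K, c ^ d = 1 ∧ x = c • y := by
  have hζR := hζ.map_of_injective (algebraMap K R).injective
  have hprod : ∏ η ∈ Polynomial.nthRootsFinset d (1 : R), (x - η * y) = 0 := by
    rw [← hζR.pow_sub_pow_eq_prod_sub_mul x y (NeZero.pos d), h, sub_self]
  obtain ⟨η, hη, hxy⟩ := Finset.prod_eq_zero_iff.mp hprod
  obtain ⟨k, -, rfl⟩ :=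
    hζR.eq_pow_of_pow_eq_one ((Polynomial.mem_nthRootsFinset (NeZero.pos d) 1).mp hη)
  refine ⟨ζ ^ k, by rw [pow_right_comm, hζ.pow_eq_one, one_pow], ?_⟩
  rw [Algebra.smul_def, map_pow, sub_eq_zero.mp hxy]

theorem vars_subset_of_dvd {σ R : Type*} [CommRing R] [IsDomain R] {p q : MvPolynomial σ R}
    (hq : q ≠ 0) (h : p ∣ q) : p.vars ⊆ q.vars := by
  obtain ⟨r, rfl⟩ := h
  intro i hi
  rw [mem_vars_iff_degreeOf_ne_zero] at hi ⊢
  rw [degreeOf_mul_eq (left_ne_zero_of_mul hq) (right_ne_zero_of_mul hq)]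
  omega

theorem isRelPrime_of_disjoint_vars {σ K : Type*} [Field K] {p q : MvPolynomial σ K}
    (hp : p ≠ 0) (hq : q ≠ 0) (h : Disjoint p.vars q.vars) : IsRelPrime p q := by
  intro r hrp hrq
  have hr : r = C (r.coeff 0) := vars_eq_empty_iff_eq_C.mp <| Finset.subset_empty.mp <|
    h (vars_subset_of_dvd hp hrp) (vars_subset_of_dvd hq hrq)
  rw [hr] at hrp ⊢
  refine (isUnit_iff_ne_zero.mpr fun h0 => hp ?_).map C
  rwa [h0, map_zero, zero_dvd_iff] at hrp

theorem isRelPrime_X_pow_sub_C {σ K : Type*} [Field K] {i j : σ} (hij : i ≠ j) (d : ℕ) [NeZero d]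
    (b c : K) : IsRelPrime (X i ^ d - C b : MvPolynomial σ K) (X j ^ d - C c) := by
  have hne : ∀ (k : σ) (a : K), (X k ^ d - C a : MvPolynomial σ K) ≠ 0 := fun k a h => by
    have := congrArg totalDegree (sub_eq_zero.mp h)
    rw [totalDegree_X_pow, totalDegree_C] at this
    exact NeZero.ne d this
  have hvars : ∀ (k : σ) (a : K), (X k ^ d - C a : MvPolynomial σ K).vars ⊆ {k} := fun k a => by
    classical
    refine (vars_sub_subset _).trans (Finset.union_subset ?_ ?_)
    · exact (vars_pow _ _).trans vars_X.subset
    · simp only [vars_C, Finset.empty_subset]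
  exact isRelPrime_of_disjoint_vars (hne i b) (hne j c)
    (Finset.disjoint_of_subset_left (hvars i b)
      (Finset.disjoint_of_subset_right (hvars j c) (Finset.disjoint_singleton.mpr hij)))

theorem exists_pow_eq_of_isUnit {σ K : Type*} [Field K] [IsAlgClosed K] {d : ℕ} [NeZero d]
    {u : MvPolynomial σ K} (hu : IsUnit u) : ∃ v, v ^ d = u := by
  obtain ⟨r, -, rfl⟩ := isUnit_iff_eq_C_of_isReduced.mp hu
  obtain ⟨z, rfl⟩ := IsAlgClosed.exists_pow_nat_eq r (NeZero.pos d)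
  exact ⟨C z, (map_pow _ _ _).symm⟩

theorem exists_coeff_single_ne_zero_of_surjective {σ τ R : Type*} [CommRing R] [Nontrivial R]
    {H : MvPolynomial σ R →ₐ[R] MvPolynomial τ R} (hH : Function.Surjective H) (i : τ) :
    ∃ j, (H (X j)).coeff (Finsupp.single i 1) ≠ 0 := by
  have hcoeff : ∀ f : MvPolynomial τ R,
      f.coeff (Finsupp.single i 1) = constantCoeff (pderiv i f) := fun f => by
    simp [constantCoeff_eq, coeff_pderiv]
  simp only [hcoeff]
  by_contra! h
  -- The tangent vector `f ↦ (∂f/∂x_i)(0)` would vanish on the image of `H`.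
  have hzero : ∀ f, constantCoeff (pderiv i (H f)) = 0 := fun f => by
    induction f using MvPolynomial.induction_on with
    | C a => simp [← algebraMap_eq]
    | add p q hp hq => rw [map_add, map_add, map_add, hp, hq, add_zero]
    | mul_X p j hp => rw [map_mul, Derivation.leibniz, map_add, smul_eq_mul, smul_eq_mul, map_mul,
        map_mul, hp, h, mul_zero, mul_zero, add_zero]
  obtain ⟨f, hf⟩ := hH (X i)
  simpa [hf] using hzero f

/-! ### Invariants of `μ_d` -/

section Invariants

variable {d n : ℕ}

theorem scalarHom_X (c : ℂ) (j : Fin n) : scalarHom n c (X j) = c • X j := by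
  rw [scalarHom, aeval_X, C_mul']

theorem coeff_scalarHom (c : ℂ) (f : MvPolynomial (Fin n) ℂ) (m : Fin n →₀ ℕ) :
    (scalarHom n c f).coeff m = c ^ m.degree * f.coeff m := by
  induction f using MvPolynomial.induction_on' with
  | monomial u a =>
    have hu : scalarHom n c (monomial u a) = C (c ^ u.degree) * monomial u a := by
      rw [scalarHom, aeval_monomial, monomial_eq, Finsupp.degree_eq_sum, algebraMap_eq,
        Finsupp.prod_fintype _ _ fun _ => pow_zero _, Finsupp.prod_fintype _ _ fun _ => pow_zero _]
      simp only [mul_pow, Finset.prod_mul_distrib, Finset.prod_pow_eq_pow_sum, map_pow]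
      ring
    rw [hu, coeff_C_mul, coeff_monomial]
    split_ifs with h
    · rw [h]
    · rw [mul_zero, mul_zero]
  | add p q hp hq => rw [map_add, coeff_add, coeff_add, hp, hq, mul_add]

variable [NeZero d]

theorem forall_mem_muSubgroup_iff
    {p : (MvPolynomial (Fin n) ℂ →ₐ[ℂ] MvPolynomial (Fin n) ℂ) → Prop} :
    (∀ h ∈ muSubgroup d n, p (h : _ →ₐ[ℂ] _)) ↔ ∀ c : ℂ, c ^ d = 1 → p (scalarHom n c) := by
  constructor
  · intro hp c hc
    lift c to ℂˣ using IsUnit.of_pow_eq_one hc (NeZero.ne d)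
    have hmem : c⁻¹ ∈ rootsOfUnity d ℂ := inv_mem ((mem_rootsOfUnity' _ _).mpr hc)
    have := hp _ (Subgroup.mem_map_of_mem (scalarAut n) hmem)
    rwa [← inv_inv c]
  · rintro hp _ ⟨c, hc, rfl⟩
    exact hp _ ((mem_rootsOfUnity' _ _).mp (inv_mem hc))

theorem mem_coordRing_iff_scalarHom {f : MvPolynomial (Fin n) ℂ} :
    f ∈ CoordRing d n ↔ ∀ c : ℂ, c ^ d = 1 → scalarHom n c f = f :=
  forall_mem_muSubgroup_iff (p := fun H => H f = f)

theorem mem_coordRing_iff_degree {f : MvPolynomial (Fin n) ℂ} :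
    f ∈ CoordRing d n ↔ ∀ m ∈ f.support, d ∣ m.degree := by
  rw [mem_coordRing_iff_scalarHom]
  constructor
  · intro hf m hm
    have hζ := Complex.isPrimitiveRoot_exp d (NeZero.ne d)
    have hcoeff := congrArg (coeff m) (hf _ hζ.pow_eq_one)
    rw [coeff_scalarHom, mul_eq_right₀ (mem_support_iff.mp hm)] at hcoeff
    exact hζ.dvd_of_pow_eq_one _ hcoeff
  · intro hf c hc
    ext m
    rw [coeff_scalarHom]
    by_cases hm : m ∈ f.support
    · obtain ⟨k, hk⟩ := hf m hm
      rw [hk, pow_mul, hc, one_pow, one_mul]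
    · rw [notMem_support_iff.mp hm, mul_zero]

theorem monomial_mem_coordRing {m : Fin n →₀ ℕ} (hm : d ∣ m.degree) (a : ℂ) :
    monomial m a ∈ CoordRing d n :=
  mem_coordRing_iff_degree.mpr fun _ hk =>
    (Finset.mem_singleton.mp (support_monomial_subset hk)) ▸ hm

theorem mem_span_monomials (f : CoordRing d n) :
    f ∈ Submodule.span ℂ
      {b : CoordRing d n | ∃ m, (b : MvPolynomial (Fin n) ℂ) = monomial m 1} := by
  have hdvd := mem_coordRing_iff_degree.mp f.2
  have hf : f = ∑ m ∈ (f : MvPolynomial (Fin n) ℂ).support.attach,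
      coeff m.1 (f : MvPolynomial (Fin n) ℂ) •
        (⟨monomial m.1 1, monomial_mem_coordRing (hdvd m.1 m.2) 1⟩ : CoordRing d n) := by
    refine Subtype.ext ?_
    conv_lhs => rw [(f : MvPolynomial (Fin n) ℂ).as_sum, ← Finset.sum_attach]
    simp only [AddSubmonoidClass.coe_finsetSum, SetLike.val_smul, smul_monomial, smul_eq_mul,
      mul_one]
  rw [hf]
  exact Submodule.sum_mem _ fun m _ =>
    Submodule.smul_mem _ _ (Submodule.subset_span ⟨m.1, rfl⟩)

variable (d) in
/-- The invariant `x_j ^ d`. The common zero locus of these is the image of the origin. -/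
def purePower (j : Fin n) : CoordRing d n :=
  ⟨X j ^ d, by
    rw [X_pow_eq_monomial]
    exact monomial_mem_coordRing (by rw [Finsupp.degree_single]) 1⟩

variable (d) in
/-- The invariant `x_i ^ (d - 1) * x_j`. For fixed `i` these generate the invariants after inverting
`x_i ^ d`. -/
def mixedPower (i j : Fin n) : CoordRing d n :=
  ⟨X i ^ (d - 1) * X j, by
    rw [X_pow_eq_monomial, X, monomial_mul]
    refine monomial_mem_coordRing ?_ _
    rw [map_add, Finsupp.degree_single, Finsupp.degree_single,
      Nat.sub_add_cancel NeZero.one_le]⟩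

theorem purePower_ne_zero (j : Fin n) : purePower d j ≠ 0 := fun h =>
  pow_ne_zero d (X_ne_zero j) (congrArg Subtype.val h)

theorem mixedPower_self (i : Fin n) : mixedPower d i i = purePower d i :=
  Subtype.ext (pow_sub_one_mul (NeZero.ne d) _)

theorem mixedPower_pow (i j : Fin n) :
    mixedPower d i j ^ d = purePower d i ^ (d - 1) * purePower d j :=
  Subtype.ext (by
    simp only [mixedPower, purePower, SubmonoidClass.mk_pow, MulMemClass.mk_mul_mk]
    ring)

theorem pow_eq_prod_purePower {b : CoordRing d n} {m : Fin n →₀ ℕ}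
    (hb : (b : MvPolynomial (Fin n) ℂ) = monomial m 1) : b ^ d = ∏ j, purePower d j ^ m j := by
  refine Subtype.ext ?_
  rw [SubmonoidClass.coe_pow, hb, monomial_eq, C_1, one_mul,
    Finsupp.prod_fintype _ _ fun _ => pow_zero _, ← Finset.prod_pow]
  simp only [purePower, SubmonoidClass.coe_finsetProd, SubmonoidClass.coe_pow, pow_right_comm]

theorem exists_mul_purePower_pow_eq {b : CoordRing d n} {m : Fin n →₀ ℕ}
    (hb : (b : MvPolynomial (Fin n) ℂ) = monomial m 1) (i : Fin n) :
    ∃ N, b * purePower d i ^ N = ∏ j, mixedPower d i j ^ m j := by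
  have hm : m ∈ (b : MvPolynomial (Fin n) ℂ).support := by
    rw [hb, mem_support_iff, coeff_monomial, if_pos rfl]
    exact one_ne_zero
  obtain ⟨N, hN⟩ := mem_coordRing_iff_degree.mp b.2 m hm
  refine ⟨(d - 1) * N, Subtype.ext ?_⟩
  simp only [purePower, mixedPower, MulMemClass.coe_mul, SubmonoidClass.coe_pow,
    SubmonoidClass.coe_finsetProd, mul_pow, Finset.prod_mul_distrib, Finset.prod_pow_eq_pow_sum,
    ← pow_mul, ← Finset.mul_sum]
  rw [hb, monomial_eq, C_1, one_mul, Finsupp.prod_fintype _ _ fun _ => pow_zero _,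
    ← Finsupp.degree_eq_sum, hN, mul_comm]
  congr 2
  ring

section Lift

variable {R : Type*} [CommRing R] [IsDomain R] [Algebra ℂ R]

theorem algHom_ext_of_mixedPower {f g : CoordRing d n →ₐ[ℂ] R} {i : Fin n}
    (hi : g (purePower d i) ≠ 0) (h : ∀ j, f (mixedPower d i j) = g (mixedPower d i j)) :
    f = g := by
  have hpure : f (purePower d i) = g (purePower d i) := mixedPower_self (d := d) i ▸ h i
  refine AlgHom.ext fun a => ?_
  have hspan : Submodule.span ℂ {b : CoordRing d n | ∃ m, (b : MvPolynomial (Fin n) ℂ) =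
      monomial m 1} ≤ Subalgebra.toSubmodule (AlgHom.equalizer f g) := by
    refine Submodule.span_le.mpr ?_
    rintro b ⟨m, hb⟩
    obtain ⟨N, hN⟩ := exists_mul_purePower_pow_eq hb i
    refine mul_right_cancel₀ (pow_ne_zero N hi) ?_
    nth_rewrite 1 [← hpure]
    rw [← map_pow, ← map_pow, ← map_mul, ← map_mul, hN]
    simp only [map_prod, map_pow, h]
  exact hspan (mem_span_monomials a)

theorem exists_algHom_comp_val_eq [UniqueFactorizationMonoid R]
    (hunit : ∀ u : R, IsUnit u → ∃ v, v ^ d = u) {θ : CoordRing d n →ₐ[ℂ] R}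
    (hθ : ∀ q, (∀ j, q ∣ θ (purePower d j)) → IsUnit q) :
    ∃ H : MvPolynomial (Fin n) ℂ →ₐ[ℂ] R, H.comp (CoordRing d n).val = θ := by
  obtain ⟨i, hi⟩ : ∃ i, θ (purePower d i) ≠ 0 := by
    by_contra! h
    exact not_isUnit_zero (hθ 0 fun j => (h j).symm ▸ dvd_rfl)
  have hmixed : ∀ j, θ (mixedPower d i j) ^ d =
      θ (purePower d i) ^ (d - 1) * θ (purePower d j) := fun j => by
    rw [← map_pow, mixedPower_pow, map_mul, map_pow]
  obtain ⟨y, hy⟩ : ∃ y, y ^ d = θ (purePower d i) := by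
    obtain ⟨y, u, hu⟩ := exists_associated_pow_of_forall_pow_eq hmixed hθ hi
    obtain ⟨v, hv⟩ := hunit u u.isUnit
    exact ⟨y * v, by rw [mul_pow, hv, hu]⟩
  have hy0 : y ≠ 0 := by
    rintro rfl
    exact hi (by rw [← hy, zero_pow (NeZero.ne d)])
  have hdvd : ∀ j, y ^ (d - 1) ∣ θ (mixedPower d i j) := fun j => by
    rw [← IsIntegrallyClosed.pow_dvd_pow_iff (NeZero.ne d), hmixed, ← hy, pow_right_comm]
    exact dvd_mul_right _ _
  choose h hh using hdvd
  have hhi : h i = y := mul_left_cancel₀ (pow_ne_zero (d - 1) hy0) (by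
    rw [← hh, mixedPower_self, ← hy, pow_sub_one_mul (NeZero.ne d)])
  refine ⟨aeval h, algHom_ext_of_mixedPower hi fun j => ?_⟩
  rw [AlgHom.comp_apply, hh, Subalgebra.coe_val, mixedPower, map_mul, map_pow, aeval_X, aeval_X,
    hhi]

theorem exists_eq_comp_scalarHom {H H' : MvPolynomial (Fin n) ℂ →ₐ[ℂ] R}
    (h : H'.comp (CoordRing d n).val = H.comp (CoordRing d n).val) :
    ∃ c : ℂ, c ^ d = 1 ∧ H' = H.comp (scalarHom n c) := by
  have hpure : ∀ j, H' (X j) ^ d = H (X j) ^ d := fun j => by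
    simpa only [AlgHom.comp_apply, Subalgebra.coe_val, purePower, map_pow] using
      DFunLike.congr_fun h (purePower d j)
  by_cases hH : ∀ i, H (X i) = 0
  · refine ⟨1, one_pow d, MvPolynomial.algHom_ext fun j => ?_⟩
    rw [scalarHom_one, AlgHom.comp_id, hH,
      eq_zero_of_pow_eq_zero ((hpure j).trans (by rw [hH, zero_pow (NeZero.ne d)]))]
  obtain ⟨i, hi⟩ := not_forall.mp hH
  obtain ⟨c, hc, hci⟩ :=
    exists_eq_smul_of_pow_eq_pow (Complex.isPrimitiveRoot_exp d (NeZero.ne d)) (hpure i)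
  refine ⟨c, hc, MvPolynomial.algHom_ext fun j => ?_⟩
  rw [AlgHom.comp_apply, scalarHom_X, map_smul]
  have hmixed : H' (X i) ^ (d - 1) * H' (X j) = H (X i) ^ (d - 1) * H (X j) := by
    simpa only [AlgHom.comp_apply, Subalgebra.coe_val, mixedPower, map_mul, map_pow] using
      DFunLike.congr_fun h (mixedPower d i j)
  rw [hci, smul_pow, smul_mul_assoc, ← mul_smul_comm] at hmixed
  rw [← mul_left_cancel₀ (pow_ne_zero _ hi) hmixed, smul_smul, mul_pow_sub_one (NeZero.ne d), hc,
    one_smul]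

end Lift

theorem exists_sub_algebraMap_mem {P : Ideal (CoordRing d n)} [P.IsPrime]
    (hP : ∀ j, purePower d j ∈ P) (a : CoordRing d n) :
    ∃ c : ℂ, a - algebraMap ℂ (CoordRing d n) c ∈ P := by
  induction mem_span_monomials a using Submodule.span_induction with
  | mem b hb =>
    obtain ⟨m, hb⟩ := hb
    obtain rfl | hm := eq_or_ne m 0
    · exact ⟨1, by rw [map_one, show b = 1 from Subtype.ext hb, sub_self]; exact P.zero_mem⟩
    · obtain ⟨j, hj⟩ := Finsupp.ne_iff.mp hm
      have hbd : b ^ d ∈ P := by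
        rw [pow_eq_prod_purePower hb]
        exact P.mem_of_dvd (Finset.dvd_prod_of_mem _ (Finset.mem_univ j))
          (Ideal.pow_mem_of_mem _ (hP j) _ (Nat.pos_of_ne_zero hj))
      exact ⟨0, by rw [map_zero, sub_zero]; exact Ideal.IsPrime.mem_of_pow_mem ‹_› _ hbd⟩
  | zero => exact ⟨0, by rw [map_zero, sub_zero]; exact P.zero_mem⟩
  | add a b _ _ iha ihb =>
    obtain ⟨⟨x, hx⟩, y, hy⟩ := iha, ihb
    exact ⟨x + y, by rw [map_add, add_sub_add_comm]; exact P.add_mem hx hy⟩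
  | smul z a _ iha =>
    obtain ⟨x, hx⟩ := iha
    refine ⟨z * x, ?_⟩
    rw [map_mul, Algebra.smul_def, ← mul_sub]
    exact P.mul_mem_left _ hx

theorem isUnit_of_forall_dvd_map_purePower [Nontrivial (Fin n)]
    (g : CoordRing d n ≃ₐ[ℂ] CoordRing d n) {q : MvPolynomial (Fin n) ℂ}
    (hq : ∀ j, q ∣ g (purePower d j)) : IsUnit q := by
  obtain ⟨i, j, hij⟩ := exists_pair_ne (Fin n)
  have hq0 : q ≠ 0 := by
    rintro rfl
    have : g (purePower d i) = 0 := Subtype.ext (zero_dvd_iff.mp (hq i))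
    exact purePower_ne_zero i ((map_eq_zero_iff g g.injective).mp this)
  by_contra hunit
  obtain ⟨p, hp, hpq⟩ := WfDvdMonoid.exists_irreducible_factor hunit hq0
  have : (Ideal.span {p}).IsPrime := (Ideal.span_singleton_prime hp.ne_zero).mpr hp.prime
  let P := (Ideal.span {p}).comap ((CoordRing d n).val.comp (g : CoordRing d n →ₐ[ℂ] CoordRing d n))
  -- Modulo `P` every invariant is a scalar, in particular `g⁻¹ (x_k ^ d)` is.
  have hP : ∀ k, purePower d k ∈ P := fun k =>
    Ideal.mem_span_singleton.mpr (hpq.trans (hq k))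
  have hdvd : ∀ k, ∃ c, p ∣ X k ^ d - C c := fun k => by
    obtain ⟨c, hc⟩ := exists_sub_algebraMap_mem hP (g.symm (purePower d k))
    refine ⟨c, ?_⟩
    simpa [P, Ideal.mem_span_singleton, purePower] using hc
  obtain ⟨⟨b, hb⟩, c, hc⟩ := hdvd i, hdvd j
  exact hp.not_isUnit (isRelPrime_X_pow_sub_C hij d b c hb hc)

end Invariants

/-! ### Lifting automorphisms -/

section LiftAut

variable {d n : ℕ} {H H' : MvPolynomial (Fin n) ℂ →ₐ[ℂ] MvPolynomial (Fin n) ℂ}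
  {g g' : CoordRing d n ≃ₐ[ℂ] CoordRing d n}

/-- `H` is the comorphism of an endomorphism of `𝔸^n` that lifts the automorphism of
`A_{d,n} = 𝔸^n / μ_d` with comorphism `g`. -/
def IsLift (H : MvPolynomial (Fin n) ℂ →ₐ[ℂ] MvPolynomial (Fin n) ℂ)
    (g : CoordRing d n ≃ₐ[ℂ] CoordRing d n) : Prop :=
  H.comp (CoordRing d n).val = (CoordRing d n).val.comp (g : CoordRing d n →ₐ[ℂ] CoordRing d n)

theorem IsLift.comp (h : IsLift H g) (h' : IsLift H' g') : IsLift (H.comp H') (g * g') :=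
  AlgHom.ext fun a =>
    (congrArg H (DFunLike.congr_fun h' a)).trans (DFunLike.congr_fun h (g' a))

theorem phi_eq_iff_isLift {G : AutMu d n} :
    phi d n G = g ↔
      IsLift ((G : MvPolynomial (Fin n) ℂ ≃ₐ[ℂ] MvPolynomial (Fin n) ℂ) : _ →ₐ[ℂ] _) g :=
  ⟨fun h => AlgHom.ext fun a => congrArg Subtype.val (DFunLike.congr_fun h a),
    fun h => AlgEquiv.ext fun a => Subtype.ext (DFunLike.congr_fun h a)⟩

theorem muHom_injective [Nonempty (Fin n)] : Function.Injective (muHom d n) := by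
  intro b c hbc
  obtain ⟨i⟩ := ‹Nonempty (Fin n)›
  have hX : scalarHom n (b⁻¹ : ℂˣ) (X i) = scalarHom n (c⁻¹ : ℂˣ) (X i) :=
    DFunLike.congr_fun (congrArg Subtype.val hbc) (X i)
  rw [scalarHom_X, scalarHom_X] at hX
  exact Subtype.ext (inv_injective (Units.ext (smul_left_injective ℂ (X_ne_zero i) hX)))

variable [NeZero d]

theorem isLift_scalarHom_one {c : ℂ} (hc : c ^ d = 1) :
    IsLift (scalarHom n c) (1 : CoordRing d n ≃ₐ[ℂ] CoordRing d n) :=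
  AlgHom.ext fun a => mem_coordRing_iff_scalarHom.mp a.2 c hc

theorem IsLift.exists_eq_scalarHom (h : IsLift H (1 : CoordRing d n ≃ₐ[ℂ] CoordRing d n)) :
    ∃ c : ℂ, c ^ d = 1 ∧ H = scalarHom n c := by
  simpa only [AlgHom.id_comp] using exists_eq_comp_scalarHom (H := AlgHom.id ℂ _) h

theorem bijective_scalarHom {c : ℂ} (hc : c ≠ 0) : Function.Bijective (scalarHom n c) :=
  (scalarAut n (Units.mk0 c hc)⁻¹).bijective

theorem mem_autMu_iff {G : MvPolynomial (Fin n) ℂ ≃ₐ[ℂ] MvPolynomial (Fin n) ℂ} :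
    G ∈ AutMu d n ↔ ∀ c : ℂ, c ^ d = 1 →
      (scalarHom n c).comp (G : _ →ₐ[ℂ] _) = (G : _ →ₐ[ℂ] _).comp (scalarHom n c) := by
  let G' : MvPolynomial (Fin n) ℂ →ₐ[ℂ] MvPolynomial (Fin n) ℂ := G
  refine Iff.trans ?_ (forall_mem_muSubgroup_iff (p := fun H => H.comp G' = G'.comp H))
  exact Subgroup.mem_centralizer_iff.trans <| forall₂_congr fun _ _ =>
    ⟨fun h => AlgHom.ext (DFunLike.congr_fun h :), fun h => AlgEquiv.ext (DFunLike.congr_fun h :)⟩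

theorem ker_phi : (phi d n).ker = (muHom d n).range := by
  ext G
  rw [MonoidHom.mem_ker, phi_eq_iff_isLift]
  constructor
  · intro h
    obtain ⟨c, hc, hG⟩ := h.exists_eq_scalarHom
    lift c to ℂˣ using IsUnit.of_pow_eq_one hc (NeZero.ne d)
    refine ⟨⟨c⁻¹, inv_mem ((mem_rootsOfUnity' _ _).mpr hc)⟩, Subtype.ext (AlgEquiv.ext fun f => ?_)⟩
    rw [← inv_inv c] at hG
    exact (DFunLike.congr_fun hG f).symm
  · rintro ⟨c, rfl⟩
    exact isLift_scalarHom_one ((mem_rootsOfUnity' _ _).mp (inv_mem c.2))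

variable [Nontrivial (Fin n)]

theorem exists_isLift (g : CoordRing d n ≃ₐ[ℂ] CoordRing d n) : ∃ H, IsLift H g :=
  exists_algHom_comp_val_eq (fun _ => exists_pow_eq_of_isUnit) fun _ =>
    isUnit_of_forall_dvd_map_purePower g

theorem IsLift.bijective (h : IsLift H g) : Function.Bijective H := by
  obtain ⟨H', h'⟩ := exists_isLift g⁻¹
  obtain ⟨b, hb, hHH'⟩ := ((mul_inv_cancel g) ▸ h.comp h').exists_eq_scalarHom
  obtain ⟨c, hc, hH'H⟩ := ((inv_mul_cancel g) ▸ h'.comp h).exists_eq_scalarHom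
  have hne : ∀ {c : ℂ}, c ^ d = 1 → c ≠ 0 := fun hc =>
    (IsUnit.of_pow_eq_one hc (NeZero.ne d)).ne_zero
  constructor
  · refine Function.Injective.of_comp (f := H') ?_
    rw [← AlgHom.coe_comp, hH'H]
    exact (bijective_scalarHom (hne hc)).injective
  · refine Function.Surjective.of_comp (g := H') ?_
    rw [← AlgHom.coe_comp, hHH']
    exact (bijective_scalarHom (hne hb)).surjective

theorem IsLift.scalarHom_comp_comm (h : IsLift H g) {c : ℂ} (hc : c ^ d = 1) :
    (scalarHom n c).comp H = H.comp (scalarHom n c) := by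
  obtain ⟨b, -, hb⟩ : ∃ b : ℂ, b ^ d = 1 ∧ (scalarHom n c).comp H = H.comp (scalarHom n b) :=
    exists_eq_comp_scalarHom (((one_mul g) ▸ (isLift_scalarHom_one hc).comp h).trans h.symm)
  obtain ⟨i⟩ : Nonempty (Fin n) := inferInstance
  obtain ⟨j, hj⟩ := exists_coeff_single_ne_zero_of_surjective h.bijective.surjective i
  have hcoeff := congrArg (coeff (Finsupp.single i 1)) (DFunLike.congr_fun hb (X j))
  rw [AlgHom.comp_apply, AlgHom.comp_apply, coeff_scalarHom, scalarHom_X, map_smul, coeff_smul,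
    Finsupp.degree_single, pow_one, smul_eq_mul] at hcoeff
  rw [hb, mul_right_cancel₀ hj hcoeff]

theorem IsLift.mem_autMu {G : MvPolynomial (Fin n) ℂ ≃ₐ[ℂ] MvPolynomial (Fin n) ℂ}
    (h : IsLift (G : _ →ₐ[ℂ] _) g) : G ∈ AutMu d n :=
  mem_autMu_iff.mpr fun _ => h.scalarHom_comp_comm

theorem phi_surjective : Function.Surjective (phi d n) := fun g => by
  obtain ⟨H, h⟩ := exists_isLift g
  have hG : AlgEquiv.ofBijective H h.bijective ∈ AutMu d n := IsLift.mem_autMu h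
  exact ⟨⟨_, hG⟩, phi_eq_iff_isLift.mpr h⟩

end LiftAut

/-! ### Polynomial curves in automorphism groups -/

namespace AffAut

variable {A B : Type*} [CommRing A] [Algebra ℂ A] [CommRing B] [Algebra ℂ B]

/-- Evaluation of a polynomial with coefficients in `A`, regarded as a curve in `A`, at `s`. -/
def evalAt (A : Type*) [CommRing A] [Algebra ℂ A] (s : ℂ) : A[X] →ₐ[ℂ] A :=
  (Polynomial.aeval (algebraMap ℂ A s)).restrictScalars ℂ

theorem evalAt_apply (s : ℂ) (p : A[X]) : evalAt A s p = p.eval (algebraMap ℂ A s) :=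
  congrFun (Polynomial.coe_aeval_eq_eval (algebraMap ℂ A s)) p

theorem evalAt_monomial (s : ℂ) (k : ℕ) (a : A) :
    evalAt A s (Polynomial.monomial k a) = s ^ k • a := by
  rw [evalAt_apply, Polynomial.eval_monomial, mul_comm, Algebra.smul_def, map_pow]

theorem evalAt_eq_sum (s : ℂ) (p : A[X]) : evalAt A s p = p.sum fun k a => s ^ k • a := by
  conv_lhs => rw [p.as_sum_support]
  simp only [map_sum, evalAt_monomial, Polynomial.sum]

theorem evalAt_injective [IsDomain A] {p q : A[X]} (h : ∀ s, evalAt A s p = evalAt A s q) :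
    p = q := by
  refine Polynomial.eq_of_infinite_eval_eq p q <|
    (Set.infinite_range_of_injective (algebraMap ℂ A).injective).mono ?_
  rintro _ ⟨s, rfl⟩
  simpa only [evalAt_apply, Set.mem_ofPred_eq] using h s

theorem evalAt_map (f : A →ₐ[ℂ] B) (s : ℂ) (p : A[X]) :
    evalAt B s (p.map (f : A →+* B)) = f (evalAt A s p) := by
  rw [evalAt_apply, evalAt_apply, Polynomial.eval_map, ← f.commutes]
  exact Polynomial.eval₂_hom (f : A →+* B) _

/-- Substitution of `q` into the parameter of a polynomial curve. -/
def reparam (A : Type*) [CommRing A] [Algebra ℂ A] (q : ℂ[X]) : A[X] →ₐ[ℂ] A[X] :=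
  (Polynomial.aeval (q.map (algebraMap ℂ A))).restrictScalars ℂ

theorem evalAt_reparam (s : ℂ) (q : ℂ[X]) (p : A[X]) :
    evalAt A s (reparam A q p) = evalAt A (q.eval s) p := by
  change evalAt A s (p.comp _) = _
  rw [evalAt_apply, Polynomial.eval_comp, Polynomial.eval_map_algebraMap,
    Polynomial.aeval_algebraMap_apply, Polynomial.coe_aeval_eq_eval, evalAt_apply]

/-- The algebra of those curves `ℂ → A` that are given by a polynomial with coefficients in `A`. -/
def polynomialCurves (A : Type*) [CommRing A] [Algebra ℂ A] : Subalgebra ℂ (ℂ → A) :=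
  (AlgHom.pi (evalAt A)).range

theorem mem_polynomialCurves_iff {γ : ℂ → A} :
    γ ∈ polynomialCurves A ↔ ∃ p : A[X], ∀ s, γ s = evalAt A s p :=
  exists_congr fun _ => ⟨fun h s => congrFun h.symm s, fun h => funext fun s => (h s).symm⟩

theorem mem_polynomialCurves_complex_iff {γ : ℂ → ℂ} :
    γ ∈ polynomialCurves ℂ ↔ ∃ p : ℂ[X], ∀ s, γ s = p.eval s := by
  simp only [mem_polynomialCurves_iff, evalAt_apply, Algebra.algebraMap_self_apply]

theorem comp_eval_mem_polynomialCurves {γ : ℂ → A} (hγ : γ ∈ polynomialCurves A) (q : ℂ[X]) :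
    (fun s => γ (q.eval s)) ∈ polynomialCurves A := by
  obtain ⟨p, hp⟩ := mem_polynomialCurves_iff.mp hγ
  exact mem_polynomialCurves_iff.mpr ⟨reparam A q p, fun s => by rw [hp, evalAt_reparam]⟩

theorem map_mem_polynomialCurves {γ : ℂ → A} (hγ : γ ∈ polynomialCurves A) (L : A →ₗ[ℂ] B) :
    (fun s => L (γ s)) ∈ polynomialCurves B := by
  obtain ⟨p, hp⟩ := mem_polynomialCurves_iff.mp hγ
  refine mem_polynomialCurves_iff.mpr ⟨p.sum fun k a => Polynomial.monomial k (L a), fun s => ?_⟩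
  simp only [hp, evalAt_eq_sum s p, Polynomial.sum, map_sum, map_smul, evalAt_monomial]

theorem mem_polynomialCurves_of_forall_linearForm {γ : ℂ → A} {F : Submodule ℂ A}
    [FiniteDimensional ℂ F] (hF : ∀ s, γ s ∈ F)
    (hγ : ∀ l : A →ₗ[ℂ] ℂ, (fun s => l (γ s)) ∈ polynomialCurves ℂ) : γ ∈ polynomialCurves A := by
  let b := Module.finBasis ℂ F
  choose l hl using fun i => LinearMap.exists_extend (b.coord i)
  have hsum : γ = ∑ i, fun s => LinearMap.toSpanSingleton ℂ A (b i : A) (l i (γ s)) := by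
    funext s
    have hcoord : ∀ i, l i (γ s) = b.repr ⟨γ s, hF s⟩ i := fun i =>
      DFunLike.congr_fun (hl i) ⟨γ s, hF s⟩
    have hrepr := congrArg Subtype.val (b.sum_repr ⟨γ s, hF s⟩)
    simpa only [Finset.sum_apply, LinearMap.toSpanSingleton_apply, hcoord, Submodule.coe_sum,
      Submodule.coe_smul] using hrepr.symm
  rw [hsum]
  exact sum_mem fun i _ => map_mem_polynomialCurves (hγ (l i)) _

theorem exists_finiteDimensional_of_mem_polynomialCurves {γ : ℂ → A}
    (hγ : γ ∈ polynomialCurves A) :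
    ∃ F : Submodule ℂ A, FiniteDimensional ℂ F ∧ ∀ s, γ s ∈ F := by
  obtain ⟨p, hp⟩ := mem_polynomialCurves_iff.mp hγ
  refine ⟨Submodule.span ℂ (p.coeff '' p.support),
    FiniteDimensional.span_of_finite ℂ (p.support.finite_toSet.image _), fun s => ?_⟩
  rw [hp, evalAt_eq_sum]
  exact sum_mem fun k hk => Submodule.smul_mem _ _ (Submodule.subset_span ⟨k, hk, rfl⟩)

theorem exists_evalAt_comp_eq [IsDomain A] {f : ℂ → B →ₐ[ℂ] A}
    (hf : ∀ b, (fun s => f s b) ∈ polynomialCurves A) :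
    ∃ Θ : B →ₐ[ℂ] A[X], ∀ s, (evalAt A s).comp Θ = f s := by
  have hinj : Function.Injective (AlgHom.pi (evalAt A)) := fun p q hpq =>
    evalAt_injective (congrFun hpq)
  let ι : A[X] ≃ₐ[ℂ] polynomialCurves A := AlgEquiv.ofInjective _ hinj
  let fc : B →ₐ[ℂ] polynomialCurves A := (AlgHom.pi f).codRestrict _ hf
  refine ⟨(ι.symm : polynomialCurves A →ₐ[ℂ] A[X]).comp fc, fun s => AlgHom.ext fun b => ?_⟩
  exact congrFun (congrArg Subtype.val (ι.apply_symm_apply (fc b))) s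

theorem IsMorphismFromLine.apply_mem_polynomialCurves {e : ℂ → (A ≃ₐ[ℂ] A)}
    (he : IsMorphismFromLine e) (a : A) : (fun s => e s a) ∈ polynomialCurves A := by
  obtain ⟨⟨V, F, hV, hF, hVF⟩, hpoly⟩ := he
  have hadjoin : Algebra.adjoin ℂ (V : Set A) ≤
      (polynomialCurves A).comap (AlgHom.pi fun s => (e s : A →ₐ[ℂ] A)) :=
    Algebra.adjoin_le fun v hv =>
      mem_polynomialCurves_of_forall_linearForm (fun s => (hVF s v hv).1) fun l =>
        mem_polynomialCurves_complex_iff.mpr (hpoly _ (Algebra.subset_adjoin ⟨v, l, Or.inl rfl⟩))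
  exact hadjoin (hV.2 ▸ Algebra.mem_top)

theorem exists_generating [Algebra.FiniteType ℂ A] : ∃ V : Submodule ℂ A, Generating V := by
  obtain ⟨s, hs⟩ := Algebra.FiniteType.out (R := ℂ) (A := A)
  exact ⟨Submodule.span ℂ s, inferInstance, by rw [Algebra.adjoin_span, hs]⟩

theorem exists_forall_mem_piece {e : ℂ → (A ≃ₐ[ℂ] A)}
    (he : ∀ a, (fun s => e s a) ∈ polynomialCurves A)
    (he' : ∀ a, (fun s => (e s).symm a) ∈ polynomialCurves A) (V : Submodule ℂ A)
    [FiniteDimensional ℂ V] :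
    ∃ F : Submodule ℂ A, FiniteDimensional ℂ F ∧ ∀ s, e s ∈ piece V F := by
  obtain ⟨S, rfl⟩ := V.fg_iff_finiteDimensional.mpr ‹_›
  choose F hF heF using fun a => exists_finiteDimensional_of_mem_polynomialCurves (he a)
  choose F' hF' heF' using fun a => exists_finiteDimensional_of_mem_polynomialCurves (he' a)
  let G : Submodule ℂ A := ⨆ a : S, F a ⊔ F' a
  have hspan : ∀ f : A →ₗ[ℂ] A, (∀ a ∈ S, f a ∈ F a ⊔ F' a) → ∀ v ∈ Submodule.span ℂ S, f v ∈ G :=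
    fun f hf => Submodule.span_le (p := G.comap f).mpr fun a ha =>
      Submodule.mem_iSup_of_mem (⟨a, ha⟩ : S) (hf a ha)
  exact ⟨G, inferInstance, fun s v hv =>
    ⟨hspan (e s).toLinearMap (fun a _ => Submodule.mem_sup_left (heF a s)) v hv,
      hspan (e s).symm.toLinearMap (fun a _ => Submodule.mem_sup_right (heF' a s)) v hv⟩⟩

theorem isMorphismFromLine_of_mem_polynomialCurves [Algebra.FiniteType ℂ A] {e : ℂ → (A ≃ₐ[ℂ] A)}
    (he : ∀ a, (fun s => e s a) ∈ polynomialCurves A)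
    (he' : ∀ a, (fun s => (e s).symm a) ∈ polynomialCurves A) : IsMorphismFromLine e := by
  constructor
  · obtain ⟨V, hV⟩ := exists_generating (A := A)
    have := hV.1
    obtain ⟨F, hF, heF⟩ := exists_forall_mem_piece he he' V
    exact ⟨V, F, hV, hF, heF⟩
  · have hadjoin : coeffAlgebra A ≤
        (polynomialCurves ℂ).comap (AlgHom.pi fun s => Pi.evalAlgHom ℂ _ (e s)) := by
      refine Algebra.adjoin_le ?_
      rintro _ ⟨a, l, rfl | rfl⟩
      · exact map_mem_polynomialCurves (he a) l
      · exact map_mem_polynomialCurves (he' a) l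
    exact fun r hr => mem_polynomialCurves_complex_iff.mp (hadjoin hr)

theorem comp_mem_coeffAlgebra {γ : ℂ → ℂ} (hγ : γ ∈ polynomialCurves ℂ) {r : (A ≃ₐ[ℂ] A) → ℂ}
    (hr : r ∈ coeffAlgebra A) : (fun g => γ (r g)) ∈ coeffAlgebra A := by
  obtain ⟨p, hp⟩ := mem_polynomialCurves_complex_iff.mp hγ
  have hcomp : (fun g => γ (r g)) = Polynomial.aeval r p := funext fun g => by
    rw [hp, Polynomial.aeval_pi_apply₂, Polynomial.coe_aeval_eq_eval]
  rw [hcomp]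
  exact Algebra.adjoin_le (Set.singleton_subset_iff.mpr hr)
    (Polynomial.aeval_mem_adjoin_singleton ℂ r)

theorem isIndClosed_of_forall_eq_zero {S : Set (A ≃ₐ[ℂ] A)} {I : Set ((A ≃ₐ[ℂ] A) → ℂ)}
    (hI : I ⊆ coeffAlgebra A) (hS : ∀ g, g ∈ S ↔ ∀ r ∈ I, r g = 0) : IsIndClosed S :=
  fun V F _ _ => ⟨I, hI, Set.ext fun g => by
    rw [Set.mem_inter_iff, hS, and_comm, Set.mem_ofPred_eq]⟩

section OneParameterSubgroup

variable {E : Multiplicative ℂ →* (A ≃ₐ[ℂ] A)} {r : (A ≃ₐ[ℂ] A) → ℂ}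

theorem isIndClosed_range (hE : ∀ a, (fun s => E (Multiplicative.ofAdd s) a) ∈ polynomialCurves A)
    (hr : r ∈ coeffAlgebra A) (hrE : ∀ s, r (E (Multiplicative.ofAdd s)) = s) :
    IsIndClosed (E.range : Set (A ≃ₐ[ℂ] A)) := by
  -- The range is the locus where `g = E (r g)`.
  let c : A → (A →ₗ[ℂ] ℂ) → (A ≃ₐ[ℂ] A) → ℂ := fun a l g =>
    l (g a) - l (E (Multiplicative.ofAdd (r g)) a)
  refine isIndClosed_of_forall_eq_zero (I := {f | ∃ a l, f = c a l}) ?_ fun g => ⟨?_, ?_⟩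
  · rintro _ ⟨a, l, rfl⟩
    exact sub_mem (Algebra.subset_adjoin ⟨a, l, Or.inl rfl⟩)
      (comp_mem_coeffAlgebra (map_mem_polynomialCurves (hE a) l) hr)
  · rintro ⟨s, rfl⟩ _ ⟨a, l, rfl⟩
    change l _ - l (E (Multiplicative.ofAdd (r (E (Multiplicative.ofAdd s.toAdd)))) a) = 0
    rw [hrE, ofAdd_toAdd, sub_self]
  · intro hg
    refine ⟨Multiplicative.ofAdd (r g), AlgEquiv.ext fun a => ?_⟩
    rw [eq_comm, ← sub_eq_zero]
    refine (Module.forall_dual_apply_eq_zero_iff ℂ _).mp fun l => ?_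
    rw [map_sub]
    exact hg _ ⟨a, l, rfl⟩

theorem isOneDimUnipotent_range [Algebra.FiniteType ℂ A]
    (hE : ∀ a, (fun s => E (Multiplicative.ofAdd s) a) ∈ polynomialCurves A)
    (hr : r ∈ coeffAlgebra A) (hrE : ∀ s, r (E (Multiplicative.ofAdd s)) = s) :
    IsOneDimUnipotent E.range := by
  have hinj : Function.Injective E :=
    Function.LeftInverse.injective (g := fun g => Multiplicative.ofAdd (r g)) fun s =>
      congrArg Multiplicative.ofAdd (hrE s.toAdd)
  have hsymm : ∀ a, (fun s => (E (Multiplicative.ofAdd s)).symm a) ∈ polynomialCurves A := by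
    intro a
    have hinv : (fun s => (E (Multiplicative.ofAdd s)).symm a) =
        fun s => E (Multiplicative.ofAdd ((-Polynomial.X : ℂ[X]).eval s)) a := funext fun s => by
      rw [Polynomial.eval_neg, Polynomial.eval_X, ofAdd_neg, map_inv, AlgEquiv.aut_inv]
    rw [hinv]
    exact comp_eval_mem_polynomialCurves (hE a) _
  refine ⟨isIndClosed_range hE hr hrE, MonoidHom.ofInjective hinj,
    isMorphismFromLine_of_mem_polynomialCurves hE hsymm, fun V F _ _ => ⟨r, hr, ?_⟩⟩
  rintro u -
  obtain ⟨s, rfl⟩ := (MonoidHom.ofInjective hinj).surjective u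
  exact (congrArg Multiplicative.toAdd (MulEquiv.symm_apply_apply _ s)).trans (hrE s.toAdd).symm

end OneParameterSubgroup

theorem IsOneDimUnipotent.exists_parametrization {U : Subgroup (A ≃ₐ[ℂ] A)}
    (hU : IsOneDimUnipotent U) :
    ∃ E : Multiplicative ℂ →* (A ≃ₐ[ℂ] A), E.range = U ∧
      (∀ a, (fun s => E (Multiplicative.ofAdd s) a) ∈ polynomialCurves A) ∧
      ∃ r ∈ coeffAlgebra A, ∀ s, r (E (Multiplicative.ofAdd s)) = s := by
  obtain ⟨-, e, he, hline⟩ := hU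
  have hpoly := he.apply_mem_polynomialCurves
  obtain ⟨⟨V, F, hV, hF, heF⟩, -⟩ := he
  obtain ⟨r, hr, hrU⟩ := hline V F hV hF
  refine ⟨U.subtype.comp e.toMonoidHom, ?_, hpoly, r, hr, fun s => ?_⟩
  · rw [MonoidHom.range_comp, MonoidHom.range_eq_top.mpr e.surjective, ← MonoidHom.range_eq_map,
      Subgroup.range_subtype]
  · exact (hrU (e (Multiplicative.ofAdd s)) (heF s)).symm.trans
      (congrArg Multiplicative.toAdd (e.symm_apply_apply (Multiplicative.ofAdd s)))

theorem exists_coeffAlgebra_comp_quotientHom (H : Subgroup (A ≃ₐ[ℂ] A))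
    {r : (invariants H ≃ₐ[ℂ] invariants H) → ℂ} (hr : r ∈ coeffAlgebra (invariants H)) :
    ∃ r' ∈ coeffAlgebra A, ∀ g : equivariant H, r' g = r (quotientHom H g) := by
  let ρ : ((A ≃ₐ[ℂ] A) → ℂ) →ₐ[ℂ] (equivariant H → ℂ) := AlgHom.pi fun g => Pi.evalAlgHom ℂ _ g.1
  let π : ((invariants H ≃ₐ[ℂ] invariants H) → ℂ) →ₐ[ℂ] (equivariant H → ℂ) :=
    AlgHom.pi fun g => Pi.evalAlgHom ℂ _ (quotientHom H g)
  suffices hle : coeffAlgebra (invariants H) ≤ ((coeffAlgebra A).map ρ).comap π by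
    obtain ⟨r', hr', h⟩ := hle hr
    exact ⟨r', hr', congrFun h⟩
  refine Algebra.adjoin_le ?_
  rintro _ ⟨a, l, hc⟩
  obtain ⟨l', hl'⟩ := LinearMap.exists_extend (p := Subalgebra.toSubmodule (invariants H)) l
  obtain rfl | rfl := hc
  · exact ⟨_, Algebra.subset_adjoin ⟨a, l', Or.inl rfl⟩,
      funext fun g => DFunLike.congr_fun hl' (quotientHom H g a)⟩
  · exact ⟨_, Algebra.subset_adjoin ⟨a, l', Or.inr rfl⟩,
      funext fun g => DFunLike.congr_fun hl' ((quotientHom H g).symm a)⟩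

end AffAut

/-! ### Lifting one-parameter groups -/

section Family

open AffAut

variable {d n : ℕ}

theorem isUnit_of_forall_isUnit_evalAt {σ : Type*} {p : (MvPolynomial σ ℂ)[X]}
    (hp : ∀ s, IsUnit (evalAt (MvPolynomial σ ℂ) s p)) : IsUnit p := by
  let ε : MvPolynomial σ ℂ →ₐ[ℂ] ℂ := aeval 0
  let p₀ : ℂ[X] := p.map (ε : MvPolynomial σ ℂ →+* ℂ)
  have hp₀ : p = p₀.map (Algebra.ofId ℂ (MvPolynomial σ ℂ) : ℂ →+* MvPolynomial σ ℂ) := by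
    refine evalAt_injective fun s => ?_
    obtain ⟨z, -, hz⟩ := isUnit_iff_eq_C_of_isReduced.mp (hp s)
    rw [evalAt_map, evalAt_map, hz, ← algebraMap_eq, ε.commutes]
    rfl
  have hdeg : p₀.degree = 0 := by
    by_contra h
    obtain ⟨s, hs⟩ := IsAlgClosed.exists_root p₀ h
    have hzero : evalAt _ s p = 0 := by
      rw [hp₀, evalAt_map, show evalAt ℂ s p₀ = 0 from hs, map_zero]
    exact not_isUnit_zero (hzero ▸ hp s)
  rw [hp₀]
  exact (Polynomial.isUnit_iff_degree_eq_zero.mpr hdeg).map (Polynomial.mapRingHom _)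

theorem eq_of_comp_val_eq_of_evalAt_eq [NeZero d] {A : Type*} [CommRing A] [IsDomain A]
    [Algebra ℂ A] {Θ Θ' : MvPolynomial (Fin n) ℂ →ₐ[ℂ] A[X]}
    (hval : Θ'.comp (CoordRing d n).val = Θ.comp (CoordRing d n).val) {s : ℂ}
    (hs : (evalAt A s).comp Θ' = (evalAt A s).comp Θ)
    (hinj : Function.Injective ((evalAt A s).comp Θ)) : Θ' = Θ := by
  obtain ⟨c, -, rfl⟩ := exists_eq_comp_scalarHom hval
  have hid : scalarHom n c = AlgHom.id ℂ _ :=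
    AlgHom.ext fun f => hinj (DFunLike.congr_fun hs f)
  rw [hid, AlgHom.comp_id]

variable [NeZero d] [Nontrivial (Fin n)]

theorem exists_isLift_family {e : ℂ → (CoordRing d n ≃ₐ[ℂ] CoordRing d n)}
    (he : ∀ a, (fun s => e s a) ∈ polynomialCurves (CoordRing d n)) :
    ∃ Θ : MvPolynomial (Fin n) ℂ →ₐ[ℂ] (MvPolynomial (Fin n) ℂ)[X],
      ∀ s, IsLift ((evalAt _ s).comp Θ) (e s) := by
  obtain ⟨θ, hθ⟩ := exists_evalAt_comp_eq
    (f := fun s => (CoordRing d n).val.comp (e s : CoordRing d n →ₐ[ℂ] CoordRing d n))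
    fun a => map_mem_polynomialCurves (he a) (CoordRing d n).val.toLinearMap
  have hunit : ∀ u : (MvPolynomial (Fin n) ℂ)[X], IsUnit u → ∃ v, v ^ d = u := fun u hu => by
    obtain ⟨z, hz, rfl⟩ := Polynomial.isUnit_iff.mp hu
    obtain ⟨v, rfl⟩ := exists_pow_eq_of_isUnit (d := d) hz
    exact ⟨Polynomial.C v, (map_pow _ _ _).symm⟩
  obtain ⟨Θ, rfl⟩ := exists_algHom_comp_val_eq hunit fun q hq =>
    isUnit_of_forall_isUnit_evalAt fun s =>
      isUnit_of_forall_dvd_map_purePower (e s) fun j =>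
        (map_dvd (evalAt _ s) (hq j)).trans (DFunLike.congr_fun (hθ s) (purePower d j)).dvd
  exact ⟨Θ, hθ⟩

variable {e : Multiplicative ℂ →* (CoordRing d n ≃ₐ[ℂ] CoordRing d n)}

theorem exists_isLift_family_normalized
    (he : ∀ a, (fun s => e (Multiplicative.ofAdd s) a) ∈ polynomialCurves (CoordRing d n)) :
    ∃ Θ : MvPolynomial (Fin n) ℂ →ₐ[ℂ] (MvPolynomial (Fin n) ℂ)[X],
      (∀ s, IsLift ((evalAt _ s).comp Θ) (e (Multiplicative.ofAdd s))) ∧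
        (evalAt _ 0).comp Θ = AlgHom.id ℂ _ := by
  obtain ⟨Θ, hΘ⟩ := exists_isLift_family he
  have hzero := hΘ 0
  rw [ofAdd_zero, map_one] at hzero
  obtain ⟨c, hc, hcΘ⟩ := hzero.exists_eq_scalarHom
  refine ⟨Θ.comp (scalarHom n c⁻¹), fun s => ?_, ?_⟩
  · have hcinv : c⁻¹ ^ d = 1 := by rw [inv_pow, hc, inv_one]
    simpa only [mul_one, AlgHom.comp_assoc] using (hΘ s).comp (isLift_scalarHom_one hcinv)
  · have hc0 : c ≠ 0 := (IsUnit.of_pow_eq_one hc (NeZero.ne d)).ne_zero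
    rw [← AlgHom.comp_assoc, hcΘ, scalarHom_comp, mul_inv_cancel₀ hc0, scalarHom_one]

theorem evalAt_add_comp_of_isLift
    {Θ : MvPolynomial (Fin n) ℂ →ₐ[ℂ] (MvPolynomial (Fin n) ℂ)[X]}
    (hΘ : ∀ s, IsLift ((evalAt _ s).comp Θ) (e (Multiplicative.ofAdd s)))
    (hzero : (evalAt _ 0).comp Θ = AlgHom.id ℂ _) (s t : ℂ) :
    (evalAt _ (s + t)).comp Θ = ((evalAt _ s).comp Θ).comp ((evalAt _ t).comp Θ) := by
  let shift := reparam (MvPolynomial (Fin n) ℂ) (Polynomial.X + Polynomial.C t)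
  have hshift : ∀ s, ((evalAt _ s).comp shift).comp Θ = (evalAt _ (s + t)).comp Θ := fun s =>
    AlgHom.ext fun f => by
      simp only [shift, AlgHom.comp_apply, evalAt_reparam, Polynomial.eval_add, Polynomial.eval_X,
        Polynomial.eval_C]
  have hcurves : Θ.comp ((evalAt _ t).comp Θ) = shift.comp Θ := by
    refine eq_of_comp_val_eq_of_evalAt_eq (d := d) (s := 0) ?_ ?_ ?_
    · refine AlgHom.ext fun a => evalAt_injective fun s => ?_
      have hlift := (hΘ s).comp (hΘ t)
      rw [← map_mul, ← ofAdd_add] at hlift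
      have hlift' := hshift s ▸ hΘ (s + t)
      exact DFunLike.congr_fun (hlift.trans hlift'.symm) a
    · rw [← AlgHom.comp_assoc, hzero, AlgHom.id_comp, ← AlgHom.comp_assoc, hshift, zero_add]
    · rw [← AlgHom.comp_assoc, hshift]
      exact (hΘ (0 + t)).bijective.injective
  rw [AlgHom.comp_assoc, hcurves, ← AlgHom.comp_assoc, hshift]

theorem exists_lift_oneParameterGroup
    (he : ∀ a, (fun s => e (Multiplicative.ofAdd s) a) ∈ polynomialCurves (CoordRing d n)) :
    ∃ E : Multiplicative ℂ →* AutMu d n, (phi d n).comp E = e ∧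
      ∀ f : MvPolynomial (Fin n) ℂ,
        (fun s => (E (Multiplicative.ofAdd s) : MvPolynomial (Fin n) ℂ ≃ₐ[ℂ] _) f) ∈
          polynomialCurves (MvPolynomial (Fin n) ℂ) := by
  obtain ⟨Θ, hΘ, hzero⟩ := exists_isLift_family_normalized he
  let H : Multiplicative ℂ →* (MvPolynomial (Fin n) ℂ →ₐ[ℂ] MvPolynomial (Fin n) ℂ) :=
    { toFun := fun s => (evalAt _ s.toAdd).comp Θ
      map_one' := hzero
      map_mul' := fun s t => evalAt_add_comp_of_isLift hΘ hzero s.toAdd t.toAdd }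
  let G : Multiplicative ℂ →* (MvPolynomial (Fin n) ℂ ≃ₐ[ℂ] MvPolynomial (Fin n) ℂ) :=
    (AlgEquiv.algHomUnitsEquiv ℂ _).toMonoidHom.comp H.toHomUnits
  have hG : ∀ s, G s ∈ AutMu d n := fun s => IsLift.mem_autMu (hΘ s.toAdd)
  exact ⟨G.codRestrict _ hG, MonoidHom.ext fun s => phi_eq_iff_isLift.mpr (hΘ s.toAdd),
    fun f => mem_polynomialCurves_iff.mpr ⟨Θ f, fun _ => rfl⟩⟩

theorem exists_isOneDimUnipotent_map_phi_eq {U : Subgroup (CoordRing d n ≃ₐ[ℂ] CoordRing d n)}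
    (hU : IsOneDimUnipotent U) :
    ∃ U' : Subgroup (AutMu d n),
      IsOneDimUnipotent (U'.map (AutMu d n).subtype) ∧ U'.map (phi d n) = U := by
  obtain ⟨e, rfl, he, r, hr, hre⟩ := hU.exists_parametrization
  obtain ⟨E, rfl, hE⟩ := exists_lift_oneParameterGroup he
  obtain ⟨r', hr', hr'r⟩ := exists_coeffAlgebra_comp_quotientHom (muSubgroup d n) hr
  refine ⟨E.range, ?_, MonoidHom.map_range _ _⟩
  rw [MonoidHom.map_range]
  exact isOneDimUnipotent_range hE hr' fun s => (hr'r _).trans (hre s)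

end Family

end

theorem proposition3p3 (d n : ℕ) (hd : 1 < d) (hn : 2 ≤ n) :
    Function.Surjective (phi d n) ∧
    (Function.Injective (muHom d n) ∧ (phi d n).ker = (muHom d n).range) ∧
    ∀ U : Subgroup (CoordRing d n ≃ₐ[ℂ] CoordRing d n), AffAut.IsOneDimUnipotent U →
      ∃ U' : Subgroup (AutMu d n),
        AffAut.IsOneDimUnipotent (U'.map (AutMu d n).subtype) ∧ U'.map (phi d n) = U := by
  have : NeZero d := ⟨by omega⟩
  have : Nontrivial (Fin n) := Fin.nontrivial_iff_two_le.mpr hn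
  exact ⟨phi_surjective, ⟨muHom_injective, ker_phi⟩, fun _ => exists_isOneDimUnipotent_map_phi_eq⟩
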